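/- Let $\mathcal M$ be a von Neumann algebra on a complex Hilbert space $\mathcal H$, and let $\mathcal Q=\mathcal P(\mathcal M)$ be the complete orthomodular lattice of its projections, with orthocomplement $P^\perp=1-P$. Write $P\to Q=P^\perp\vee(P\wedge Q)$, and say that $P$ and $Q$ commute if $P=(P\wedge Q)\vee(P\wedge Q^\perp)$. For $\mathcal A\subseteq\mathcal Q$ let $\mathrm{com}(\mathcal A)$ be the supremum of all $E\in\mathcal Q$ that commute with every element of $\mathcal A$ and are such that $P_1\wedge E$ and $P_2\wedge E$ commute for all $P_1,P_2\in\mathcal A$. Let $V^{(\mathcal Q)}$ be the universe of $\mathcal Q$-valued sets, i.e. of functions $u:\mathrm{dom}(u)\to\mathcal Q$ whose domain is a set of $\mathcal Q$-valued sets (built up recursively), with the truth values $$[\![u=v]\!]=\bigwedge_{u'\in\mathrm{dom}(u)}\bigl(u(u')\to[\![u'\in v]\!]\bigr)\wedge\bigwedge_{v'\in\mathrm{dom}(v)}\bigl(v(v')\to[\![v'\in u]\!]\bigr),\qquad [\![u\in v]\!]=\bigvee_{v'\in\mathrm{dom}(v)}\bigl(v(v')\wedge[\![u=v']\!]\bigr),$$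 and the support $L(u)=\bigcup_{x\in\mathrm{dom}(u)}L(x)\cup\{u(x):x\in\mathrm{dom}(u)\}$. For a set $v$ let $\check v$ be the $\mathcal Q$-valued set with domain $\{\check w: w\in v\}$ and constant value $1$. An observable is a densely defined self-adjoint operator $X$ on $\mathcal H$ affiliated with $\mathcal M$. Let $E^X(\lambda)$, $\lambda\in\mathbf R$, be its resolution of identity, and let $\tilde X\in V^{(\mathcal Q)}$ have domain $\{\check r: r\in\mathbf Q\}$ and values $\tilde X(\check r)=E^X(r)$. For observables $X_1,\dots,X_n$ put $\mathrm{com}(\tilde X_1,\dots,\tilde X_n)=\mathrm{com}\bigl(L(\tilde X_1)\cup\dots\cup L(\tilde X_n)\bigr)$. Observational propositions in $\mathcal L_o(X_1,\dots,X_n)$ are built with $\neg$ and $\wedge$ from the atoms $X_j\le_o x$ ($x\in\mathbf R$) and $X_j=_oX_k$. Their truth values in $\mathcal Q$ are given by $[\![X\le_o x]\!]_o=E^X(x)$, $[\![X=_oY]\!]_o=[\![\tilde X=\tilde Y]\!]$, $[\![\neg\phi]\!]_o=[\![\phi]\!]_o^\perp$ and $[\![\phi_1\wedge\phi_2]\!]_o=[\![\phi_1]\!]_o\wedge[\![\phi_2]\!]_o$.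 Such a $\phi$ is called a tautology in classical logic if it is true under every assignment of real numbers to the symbols for observables occurring in it, with $\le_o$ and $=_o$ read as the order and equality of real numbers; in particular, every propositional tautology in the atoms and every quantifier-free validity of first-order logic with equality is one. A state is a density operator $\rho$ on $\mathcal H$ (positive, trace one). The proposition $\phi$ holds in $\rho$ if $\mathrm{Tr}([\![\phi]\!]_o\,\rho)=1$, and $\phi\in\mathcal L_o(X_1,\dots,X_n)$ is contextually well-formed in $\rho$ if $X_1,\dots,X_n$ are simultaneously determinate in $\rho$, i.e. $\mathrm{Tr}(\mathrm{com}(\tilde X_1,\dots,\tilde X_n)\,\rho)=1$. **Theorem.** Let $\phi$ be an observational proposition in $\mathcal L_o(X_1,\dots,X_n)$ that is a tautology in classical logic. Then $$\mathrm{com}(\tilde X_1,\dots,\tilde X_n)\le[\![\phi]\!]_o .$$ Moreover, if $\phi$ is contextually well-formed in a state $\rho$, then $\phi$ holds in $\rho$. -/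

import Mathlib

universe u

namespace QuantumSet

/-! ### Logics: commutation, implication, commutator -/

section Logic

variable {Q : Type u} [CompleteLattice Q] [Compl Q]

/-- `P` and `Q` commute: `P = (P ∧ Q) ∨ (P ∧ Qᗮ)`. -/
def Commutes (p q : Q) : Prop := p = (p ⊓ q) ⊔ (p ⊓ qᶜ)

/-- The implication `P → Q := Pᗮ ∨ (P ∧ Q)`. -/
def imp (p q : Q) : Q := pᶜ ⊔ (p ⊓ q)

/-- The commutant `A^!` of a subset of a logic. -/
def commutant (A : Set Q) : Set Q := {p | ∀ q ∈ A, Commutes p q}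

/-- The commutator `com(A) = ⋁ T(A)`, where `T(A)` is the set of all `E ∈ A^!` such that
`P₁ ∧ E` and `P₂ ∧ E` commute for all `P₁, P₂ ∈ A`. -/
def com (A : Set Q) : Q :=
  sSup {e | e ∈ commutant A ∧ ∀ p₁ ∈ A, ∀ p₂ ∈ A, Commutes (p₁ ⊓ e) (p₂ ⊓ e)}

end Logic

/-! ### The universe of `Q`-valued sets -/

/-- The universe `V^(Q)`: a `Q`-valued set is a `Q`-valued function on a set of `Q`-valued sets,
given here as a family of members with their values (as in the type `PSet` of pre-sets). -/
inductive QSet (Q : Type u) : Type (u + 1)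
  | mk (ι : Type u) (dom : ι → QSet Q) (val : ι → Q) : QSet Q

namespace QSet

section

variable {Q : Type u} [CompleteLattice Q] [Compl Q]

/-- The index type of the domain of a `Q`-valued set. -/
def Index : QSet Q → Type u
  | mk ι _ _ => ι

/-- The members of the domain of a `Q`-valued set. -/
def dom : (a : QSet Q) → a.Index → QSet Q
  | mk _ d _ => d

/-- The value that a `Q`-valued set gives to the members of its domain. -/
def val : (a : QSet Q) → a.Index → Q
  | mk _ _ f => f

/-- The truth value of `a = b`. See `eqVal_def` for the recursion rule. -/
def eqVal : QSet Q → QSet Q → Q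
  | mk ι d f, mk κ e g =>
    (⨅ i : ι, imp (f i) (⨆ k : κ, g k ⊓ eqVal (d i) (e k))) ⊓
      (⨅ k : κ, imp (g k) (⨆ i : ι, f i ⊓ eqVal (d i) (e k)))

/-- The truth value of `a ∈ b`. -/
def memVal (a b : QSet Q) : Q := ⨆ k : b.Index, b.val k ⊓ eqVal a (b.dom k)

theorem eqVal_symm (a b : QSet Q) : eqVal a b = eqVal b a := by
  induction a generalizing b with
  | mk ι d f ih =>
    cases b with
    | mk κ e g =>
      simp only [eqVal]
      rw [inf_comm]
      simp only [ih]

/-- The recursion rule for the truth values of atomic formulas. -/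
theorem eqVal_def (a b : QSet Q) :
    eqVal a b = (⨅ i : a.Index, imp (a.val i) (memVal (a.dom i) b)) ⊓
      (⨅ k : b.Index, imp (b.val k) (memVal (b.dom k) a)) := by
  cases a with
  | mk ι d f =>
    cases b with
    | mk κ e g =>
      simp only [eqVal, memVal, Index, dom, val]
      congr 1
      refine iInf_congr fun k => congrArg (imp (g k)) (iSup_congr fun i => ?_)
      rw [eqVal_symm]

/-- The support `L(a)` of a `Q`-valued set. -/
def support : QSet Q → Set Q
  | mk _ d f => (⋃ i, support (d i)) ∪ Set.range f

/-- The commutator of a class of `Q`-valued sets. -/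
def com (A : Set (QSet Q)) : Q := QuantumSet.com (⋃ a ∈ A, support a)

/-- The canonical embedding `v ↦ v̌` of the universe of sets in `V^(Q)`. -/
def check : PSet.{u} → QSet Q
  | PSet.mk ι d => mk ι (fun i => check (d i)) (fun _ => ⊤)

end

end QSet

/-- The set-theoretic code of a rational number: rationals are coded by distinct finite
von Neumann ordinals. -/
def ratCode (r : ℚ) : PSet.{u} := PSet.ofNat (Encodable.encode r)

/-! ### The logic of projections of a von Neumann algebra -/

section Operators

variable {H : Type u} [NormedAddCommGroup H] [InnerProductSpace ℂ H] [CompleteSpace H]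

/-- The projections `P(M)` of a von Neumann algebra `M`, with the operator ordering. -/
structure Projection (M : VonNeumannAlgebra H) : Type u where
  /-- The projection as a bounded operator. -/
  op : H →L[ℂ] H
  isStarProjection : IsStarProjection op
  mem : op ∈ M

namespace Projection

variable {M : VonNeumannAlgebra H}

theorem op_injective : Function.Injective (op : Projection M → (H →L[ℂ] H)) := by
  rintro ⟨p, _, _⟩ ⟨q, _, _⟩ h
  cases h
  rfl

noncomputable instance : PartialOrder (Projection M) := PartialOrder.lift op op_injective

theorem le_iff_op_le {p q : Projection M} : p ≤ q ↔ p.op ≤ q.op := Iff.rfl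

theorem le_iff_range_le {p q : Projection M} :
    p ≤ q ↔ p.op.range ≤ q.op.range := by
  obtain ⟨_, hp⟩ := isStarProjection_iff_eq_starProjection_range.1 p.isStarProjection
  obtain ⟨_, hq⟩ := isStarProjection_iff_eq_starProjection_range.1 q.isStarProjection
  rw [le_iff_op_le, ← Submodule.starProjection_le_starProjection_iff, ← hp, ← hq]

/-- The intersection of the ranges of a set of projections. -/
def rangeInf (S : Set (Projection M)) : Submodule ℂ H := ⨅ p ∈ S, p.op.range

theorem isClosed_rangeInf (S : Set (Projection M)) : IsClosed (rangeInf S : Set H) := by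
  simp only [rangeInf, Submodule.coe_iInf]
  refine isClosed_iInter fun p => isClosed_iInter fun _ => ?_
  exact ContinuousLinearMap.IsIdempotentElem.isClosed_range p.isStarProjection.isIdempotentElem

theorem rangeInf_complete (S : Set (Projection M)) : CompleteSpace (rangeInf S) :=
  (isClosed_rangeInf S).completeSpace_coe

/-- The infimum of a set of projections: the projection onto the intersection of the ranges. -/
noncomputable instance : InfSet (Projection M) where
  sInf S :=
    haveI := rangeInf_complete S
    ⟨(rangeInf S).starProjection, isStarProjection_starProjection, by
      rw [VonNeumannAlgebra.IsStarProjection.mem_iff isStarProjection_starProjection]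
      intro y hy
      rw [Submodule.range_starProjection]
      simp only [Module.End.mem_invtSubmodule, rangeInf]
      intro x hx
      simp only [Submodule.mem_iInf, Submodule.mem_comap] at hx ⊢
      intro p hp
      have := (VonNeumannAlgebra.IsStarProjection.mem_iff p.isStarProjection M).1 p.mem y hy
      exact this (hx p hp)⟩

theorem range_sInf (S : Set (Projection M)) : (sInf S).op.range = rangeInf S := by
  have := rangeInf_complete S
  exact Submodule.range_starProjection _

theorem isGLB_sInf (S : Set (Projection M)) : IsGLB S (sInf S) := by
  constructor
  · intro p hp
    rw [le_iff_range_le, range_sInf]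
    exact iInf₂_le p hp
  · intro q hq
    rw [le_iff_range_le, range_sInf]
    exact le_iInf₂ fun p hp => le_iff_range_le.1 (hq hp)

noncomputable instance : CompleteLattice (Projection M) :=
  completeLatticeOfInf _ isGLB_sInf

/-- The orthocomplement `Pᗮ = 1 - P`. -/
noncomputable instance : Compl (Projection M) where
  compl p := ⟨1 - p.op, p.isStarProjection.one_sub, sub_mem (one_mem M) p.mem⟩

end Projection

/-! ### Observables and their resolutions of identity -/

/-- `A η M`: the operator `A` is affiliated with `M`, i.e. `U* A U = A` (with equality of
domains) for every unitary `U` in the commutant of `M`. -/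
def Affiliated (A : H →ₗ.[ℂ] H) (M : VonNeumannAlgebra H) : Prop :=
  ∀ U ∈ M.commutant, U ∈ unitary (H →L[ℂ] H) →
    (∀ ψ : H, U ψ ∈ A.domain ↔ ψ ∈ A.domain) ∧
      ∀ (ψ : H) (h : ψ ∈ A.domain) (h' : U ψ ∈ A.domain),
        star U (A ⟨U ψ, h'⟩) = A ⟨ψ, h⟩

/-- An observable of the system described by `M`: a densely defined self-adjoint operator
affiliated with `M`. -/
structure Observable (M : VonNeumannAlgebra H) where
  toOp : H →ₗ.[ℂ] H
  dense : Dense (toOp.domain : Set H)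
  selfAdjoint : IsSelfAdjoint toOp
  affiliated : Affiliated toOp M

/-- A resolution of identity in `P(M)`. -/
structure Resolution (M : VonNeumannAlgebra H) where
  proj : ℝ → Projection M
  mono : Monotone proj
  rightCont : ∀ l : ℝ, proj l = ⨅ m : Set.Ioi l, proj m
  iInf_eq : ⨅ l, proj l = ⊥
  iSup_eq : ⨆ l, proj l = ⊤

instance (M : VonNeumannAlgebra H) : Nonempty (Resolution M) := by
  classical
  refine ⟨⟨fun l => if 0 ≤ l then ⊤ else ⊥, ?_, ?_, ?_, ?_⟩⟩
  · intro a b hab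
    dsimp only
    split_ifs with h1 h2
    · exact le_rfl
    · exact absurd (h1.trans hab) h2
    · exact bot_le
    · exact le_rfl
  · intro l
    by_cases hl : 0 ≤ l
    · rw [if_pos hl]
      symm
      rw [iInf_eq_top]
      rintro ⟨m, hm⟩
      exact if_pos (hl.trans (le_of_lt hm))
    · rw [if_neg hl]
      symm
      push Not at hl
      rw [eq_bot_iff]
      refine (iInf_le _ (⟨l / 2, by simp only [Set.mem_Ioi]; linarith⟩ : Set.Ioi l)).trans ?_
      rw [if_neg (by simp only; linarith)]
  · rw [eq_bot_iff]
    refine (iInf_le _ (-1 : ℝ)).trans ?_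
    rw [if_neg (by norm_num)]
  · rw [eq_top_iff]
    refine le_trans ?_ (le_iSup _ (0 : ℝ))
    rw [if_pos le_rfl]

open MeasureTheory in
/-- `E` is the resolution of identity belonging to `A`, i.e. `A = ∫ λ dE(λ)`: with `μ` the measure
`d‖E(λ)ψ‖²`, the vector `ψ` lies in the domain of `A` iff `∫ λ² dμ < ∞`, and then
`⟨ψ, Aψ⟩ = ∫ λ dμ`. -/
def Resolution.BelongsTo {M : VonNeumannAlgebra H} (E : Resolution M) (A : H →ₗ.[ℂ] H) : Prop :=
  ∀ ψ : H, ∃ μ : Measure ℝ,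
    (∀ l : ℝ, μ (Set.Iic l) = ENNReal.ofReal (‖(E.proj l).op ψ‖ ^ 2)) ∧
    (ψ ∈ A.domain ↔ ∫⁻ l, ENNReal.ofReal (l ^ 2) ∂μ < ⊤) ∧
    ∀ h : ψ ∈ A.domain, inner ℂ ψ (A ⟨ψ, h⟩) = ((∫ l, l ∂μ : ℝ) : ℂ)

namespace Observable

variable {M : VonNeumannAlgebra H}

/-- The resolution of identity `E^X` belonging to the observable `X`; by the spectral theorem
there is exactly one. -/
noncomputable def resolution (X : Observable M) : Resolution M :=
  Classical.epsilon fun E : Resolution M => E.BelongsTo X.toOp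

/-- The real number `X̃ = {(ř, E^X(r)) ∣ r ∈ ℚ}` of `V^(P(M))` corresponding to `X`. -/
noncomputable def tilde (X : Observable M) : QSet (Projection M) :=
  QSet.mk (ULift.{u} ℚ) (fun r => QSet.check (ratCode r.down))
    (fun r => X.resolution.proj (r.down : ℝ))

end Observable

/-! ### States -/

variable (H) in
/-- The index set of a Hilbert basis of `H`. -/
noncomputable def basisIndex : Set H := (exists_hilbertBasis ℂ H).choose

variable (H) in
/-- A Hilbert basis of `H`. -/
noncomputable def hilbertBasis : HilbertBasis (basisIndex H) ℂ H :=
  (exists_hilbertBasis ℂ H).choose_spec.choose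

/-- The trace of an operator (meaningful for trace class operators). -/
noncomputable def trace (T : H →L[ℂ] H) : ℂ :=
  ∑' i, inner ℂ (hilbertBasis H i) (T (hilbertBasis H i))

variable (H) in
/-- The states: density operators, i.e. positive operators of trace one. -/
structure DensityOperator where
  op : H →L[ℂ] H
  isPositive : op.IsPositive
  hasTrace_one : HasSum (fun i => inner ℂ (hilbertBasis H i) (op (hilbertBasis H i))) (1 : ℂ)

/-! ### Observational propositions -/

/-- Observational propositions with atoms `X ≤ₒ x` and `X =ₒ Y`. -/
inductive ObsProp (M : VonNeumannAlgebra H) : Type u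
  | le (X : Observable M) (x : ℝ) : ObsProp M
  | eq (X Y : Observable M) : ObsProp M
  | neg (φ : ObsProp M) : ObsProp M
  | and (φ₁ φ₂ : ObsProp M) : ObsProp M

/-- `com(X̃₁,…,X̃ₙ)`. -/
noncomputable def comObs {M : VonNeumannAlgebra H} {n : ℕ} (X : Fin n → Observable M) :
    Projection M :=
  QSet.com (Set.range fun j => (X j).tilde)

/-- `X₁,…,Xₙ` are simultaneously determinate in the state `ρ`: `Tr[com(X̃₁,…,X̃ₙ)ρ] = 1`. -/
def SimultaneouslyDeterminate {M : VonNeumannAlgebra H} {n : ℕ} (X : Fin n → Observable M)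
    (ρ : DensityOperator H) : Prop :=
  trace ((comObs X).op * ρ.op) = 1

namespace ObsProp

variable {M : VonNeumannAlgebra H}

/-- `φ` is an observational proposition in `L_o(X₁,…,Xₙ)`: only observables from the list
`X₁,…,Xₙ` occur in `φ`. -/
def InLanguage {n : ℕ} (X : Fin n → Observable M) : ObsProp M → Prop
  | le Y _ => Y ∈ Set.range X
  | eq Y Z => Y ∈ Set.range X ∧ Z ∈ Set.range X
  | neg φ => φ.InLanguage X
  | and φ₁ φ₂ => φ₁.InLanguage X ∧ φ₂.InLanguage X

/-- The projection-valued truth value of an observational proposition. -/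
noncomputable def truth : ObsProp M → Projection M
  | le X x => X.resolution.proj x
  | eq X Y => QSet.eqVal X.tilde Y.tilde
  | neg φ => (φ.truth)ᶜ
  | and φ₁ φ₂ => φ₁.truth ⊓ φ₂.truth

/-- The classical truth value of `φ` under a given assignment of truth values to the atoms. -/
def Eval (tle : Observable M → ℝ → Prop) (teq : Observable M → Observable M → Prop) :
    ObsProp M → Prop
  | le X x => tle X x
  | eq X Y => teq X Y
  | neg φ => ¬ φ.Eval tle teq
  | and φ₁ φ₂ => φ₁.Eval tle teq ∧ φ₂.Eval tle teq

/-- `φ` is a tautology in classical logic, where the symbols for observables are variables for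
real numbers and `≤ₒ`, `=ₒ` are the order and the equality of real numbers: `φ` is true whatever
real values its variables have. In particular, this includes all propositional tautologies
(`isTautology_of_propositional`) and all quantifier-free validities of first-order logic with
equality. -/
def IsTautology (φ : ObsProp M) : Prop :=
  ∀ v : Observable M → ℝ, φ.Eval (fun X x => v X ≤ x) (fun X Y => v X = v Y)

/-- A proposition that is true under every assignment of truth values to its atoms is a tautology
in the above sense. -/
theorem isTautology_of_propositional {φ : ObsProp M} (h : ∀ tle teq, φ.Eval tle teq) :
    φ.IsTautology := fun _ => h _ _

/-- `φ(X₁,…,Xₙ)` is contextually well-formed in the state `ρ`. -/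
def ContextuallyWellFormed {n : ℕ} (φ : ObsProp M) (X : Fin n → Observable M)
    (ρ : DensityOperator H) : Prop :=
  φ.InLanguage X ∧ SimultaneouslyDeterminate X ρ

/-- `φ` holds in the state `ρ`: `Pr{φ‖ρ} = Tr[⟦φ⟧ρ] = 1`. -/
def Holds (φ : ObsProp M) (ρ : DensityOperator H) : Prop :=
  trace (φ.truth.op * ρ.op) = 1

end ObsProp

end Operators

end QuantumSet

/-! Let `e` be one of the projections whose supremum is the commutator. The rational spectral
projections of the `X j` commute with `e` and commute with each other on its range; this is
`Reduces`, and it passes to the smaller projections obtained by cutting with these spectral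
projections or their complements. On such projections the argument is a forcing argument, in which a
nonzero reducing projection plays the role of a condition.

Every nonzero condition can be shrunk to a nonzero condition lying below a given atom or below its
orthocomplement (`exists_decidesLE`, `exists_decidesEq`). As finitely many atoms matter, one nonzero
condition `k` decides them all. Its decisions are those of an assignment of real numbers
(`exists_assignment`), and induction on the proposition (`ObsProp.le_truth_of_atoms`) puts `k` below
the truth value of everything true under that assignment, in particular of a tautology. So
conditions below the truth value are dense below `e`, and an exhaustion argument
(`Reduces.le_of_dense`) puts `e` itself below it. No commutation of the truth value with the
spectral projections is needed.

For states, `Tr(Pρ) = 1` forces `Pρ = ρ` (`mul_eq_of_trace_mul_eq_one`), a property that passes from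
a projection to every larger one. -/

namespace QuantumSet

/-! ### Lattice operations and commuting projections -/

namespace Projection

variable {H : Type u} [NormedAddCommGroup H] [InnerProductSpace ℂ H] [CompleteSpace H]
  {M : VonNeumannAlgebra H}

theorem le_iff_mul_eq {p q : Projection M} : p ≤ q ↔ p.op * q.op = p.op :=
  le_iff_op_le.trans (p.isStarProjection.le_iff_mul_eq_left q.isStarProjection)

theorem op_mul_self (p : Projection M) : p.op * p.op = p.op :=
  p.isStarProjection.isIdempotentElem

@[simp] theorem op_compl (p : Projection M) : (pᶜ).op = 1 - p.op := rfl

@[simp] theorem compl_compl_eq (p : Projection M) : pᶜᶜ = p :=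
  op_injective (by simp)

theorem compl_le_compl_of_le {p q : Projection M} (h : p ≤ q) : qᶜ ≤ pᶜ := by
  rw [le_iff_op_le] at h ⊢
  exact sub_le_sub_left h 1

theorem compl_le_iff {p q : Projection M} : pᶜ ≤ q ↔ qᶜ ≤ p := by
  constructor <;> intro h <;> simpa using compl_le_compl_of_le h

theorem op_bot : (⊥ : Projection M).op = 0 := by
  let z : Projection M := ⟨0, .zero _, zero_mem M⟩
  have hz : (⊥ : Projection M) ≤ z := bot_le
  rw [le_iff_mul_eq] at hz
  simpa [z] using hz.symm

theorem op_top : (⊤ : Projection M).op = 1 := by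
  let z : Projection M := ⟨1, .one _, one_mem M⟩
  have hz : z ≤ (⊤ : Projection M) := le_top
  rw [le_iff_mul_eq] at hz
  simpa [z] using hz

theorem compl_top_eq : (⊤ : Projection M)ᶜ = ⊥ :=
  op_injective (by simp [op_top, op_bot])

theorem le_compl_iff_mul_eq_zero {p q : Projection M} : p ≤ qᶜ ↔ p.op * q.op = 0 := by
  simp [le_iff_mul_eq, mul_sub]

theorem eq_bot_of_le_of_le_compl {p q : Projection M} (h : p ≤ q) (h' : p ≤ qᶜ) : p = ⊥ := by
  apply op_injective
  rw [op_bot, ← le_iff_mul_eq.1 h, le_compl_iff_mul_eq_zero.1 h']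

/-- De Morgan's law gives access to suprema, since the lattice structure is built from infima alone.
-/
theorem compl_sInf_image_compl (S : Set (Projection M)) : (sInf (compl '' S))ᶜ = sSup S := by
  apply le_antisymm
  · rw [compl_le_iff]
    refine le_sInf ?_
    rintro _ ⟨p, hp, rfl⟩
    exact compl_le_compl_of_le (le_sSup hp)
  · refine sSup_le fun p hp => ?_
    have h : sInf (compl '' S) ≤ pᶜ := sInf_le ⟨p, hp, rfl⟩
    simpa using compl_le_compl_of_le h

theorem op_inf_of_commute {p q : Projection M} (h : Commute p.op q.op) :
    (p ⊓ q).op = p.op * q.op := by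
  let r : Projection M := ⟨p.op * q.op, p.isStarProjection.mul q.isStarProjection h,
    mul_mem p.mem q.mem⟩
  suffices p ⊓ q = r by rw [this]
  apply le_antisymm
  · have h1 := le_iff_mul_eq.1 (inf_le_left : p ⊓ q ≤ p)
    have h2 := le_iff_mul_eq.1 (inf_le_right : p ⊓ q ≤ q)
    rw [le_iff_mul_eq]
    simp only [r]
    rw [← mul_assoc, h1, h2]
  · refine le_inf ?_ ?_ <;> rw [le_iff_mul_eq] <;> simp only [r]
    · rw [h.eq, mul_assoc, op_mul_self]
    · rw [mul_assoc, op_mul_self]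

theorem commute_of_le {p q : Projection M} (h : p ≤ q) : Commute p.op q.op :=
  p.isStarProjection.commute_of_le q.isStarProjection h

theorem commute_compl {p q : Projection M} (h : Commute p.op q.op) : Commute p.op (qᶜ).op :=
  (Commute.one_right _).sub_right h

theorem commute_sInf {q : Projection M} {S : Set (Projection M)}
    (h : ∀ p ∈ S, Commute q.op p.op) : Commute q.op (sInf S).op := by
  set r := sInf S
  -- By commutation `q` maps the range of each `p ∈ S` into itself, hence also their intersection,
  -- the range of `r`.
  have key : r.op * (q.op * r.op) = q.op * r.op := by
    ext x
    have hx : q.op (r.op x) ∈ r.op.range := by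
      rw [range_sInf]
      simp only [rangeInf, Submodule.mem_iInf]
      intro p hp
      refine ⟨q.op (r.op x), ?_⟩
      have h1 := DFunLike.congr_fun (h p hp).eq (r.op x)
      have h2 := DFunLike.congr_fun (commute_of_le (sInf_le hp : r ≤ p)).eq x
      have h3 := DFunLike.congr_fun (le_iff_mul_eq.1 (sInf_le hp : r ≤ p)) x
      simp only [mul_apply_eq_comp] at h1 h2 h3
      simp only [ContinuousLinearMap.coe_coe]
      rw [← h1, ← h2, h3]
    obtain ⟨y, hy⟩ := hx
    have := DFunLike.congr_fun (op_mul_self r) y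
    simp only [mul_apply_eq_comp, ContinuousLinearMap.coe_coe] at this hy ⊢
    rw [← hy, this]
  -- The adjoint of `r q r = q r` is `r q r = r q`.
  have := congrArg star key
  simp only [star_mul, r.isStarProjection.isSelfAdjoint.star_eq,
    q.isStarProjection.isSelfAdjoint.star_eq] at this
  rw [Commute, SemiconjBy, ← key, ← mul_assoc, this]

theorem commute_sSup {q : Projection M} {S : Set (Projection M)}
    (h : ∀ p ∈ S, Commute q.op p.op) : Commute q.op (sSup S).op := by
  rw [← compl_sInf_image_compl]
  refine commute_compl (commute_sInf ?_)
  rintro _ ⟨p, hp, rfl⟩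
  exact commute_compl (h p hp)

/-- Lattice commutation writes `p` as a supremum of two projections, one below `q` and one below
`qᶜ`; each commutes with `q` as an operator. -/
theorem commute_of_commutes {p q : Projection M} (h : Commutes p q) : Commute p.op q.op := by
  rw [Commutes, ← sSup_pair] at h
  rw [h]
  refine (commute_sSup ?_).symm
  rintro _ (rfl | rfl)
  · exact (commute_of_le inf_le_right).symm
  · have := commute_compl (commute_of_le (inf_le_right : p ⊓ qᶜ ≤ qᶜ))
    rw [compl_compl_eq] at this
    exact this.symm

theorem le_of_inf_compl_eq_bot {p q : Projection M} (h : Commute p.op q.op)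
    (h' : p ⊓ qᶜ = ⊥) : p ≤ q := by
  have := congrArg op h'
  rw [op_inf_of_commute (commute_compl h), op_bot, op_compl, mul_sub, mul_one,
    sub_eq_zero] at this
  exact le_iff_mul_eq.2 this.symm

/-- Split `p = pq + p(1 - q)`: right multiplication by the supremum fixes both summands. -/
theorem le_sup_of_commute {p q : Projection M} (h : Commute p.op q.op) :
    p ≤ qᶜ ⊔ (p ⊓ q) := by
  set s := qᶜ ⊔ (p ⊓ q)
  have h1 : (p ⊓ q).op * s.op = (p ⊓ q).op := le_iff_mul_eq.1 le_sup_right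
  have h2 : (qᶜ).op * s.op = (qᶜ).op := le_iff_mul_eq.1 le_sup_left
  rw [op_inf_of_commute h] at h1
  rw [op_compl] at h2
  rw [le_iff_mul_eq]
  calc p.op * s.op = p.op * q.op * s.op + p.op * ((1 - q.op) * s.op) := by noncomm_ring
    _ = p.op := by rw [h1, h2]; noncomm_ring

/-- Both `pᶜ` and `p ⊓ q` lie below `(p ⊓ qᶜ)ᶜ`; no commutation is needed. -/
theorem inf_compl_le_compl_imp (p q : Projection M) : p ⊓ qᶜ ≤ (imp p q)ᶜ := by
  have : imp p q ≤ (p ⊓ qᶜ)ᶜ := by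
    refine sup_le (compl_le_compl_of_le inf_le_left) ?_
    have := compl_le_compl_of_le (inf_le_right : p ⊓ qᶜ ≤ qᶜ)
    rw [compl_compl_eq] at this
    exact inf_le_right.trans this
  simpa using compl_le_compl_of_le this

end Projection

/-! ### Truth values of equality for check names and for observables -/

section Check

variable {Q : Type u} [CompleteLattice Q] [Compl Q]

/-- All values of check names are `⊤`, and `imp ⊤ q = q`, so the recursion for equality of check
names is that of extensional equivalence of pre-sets, with only the values `⊤` and `⊥`. -/
theorem QSet.eqVal_check (htop : (⊤ : Q)ᶜ = ⊥) (x y : PSet.{u}) :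
    (x.Equiv y → eqVal (check x : QSet Q) (check y) = ⊤) ∧
      (¬ x.Equiv y → eqVal (check x : QSet Q) (check y) = ⊥) := by
  induction x generalizing y with
  | mk ι d ih =>
    obtain ⟨κ, e⟩ := y
    have himp (q : Q) : imp ⊤ q = q := by simp [imp, htop]
    simp only [check, eqVal, himp, top_inf_eq]
    constructor
    · rintro ⟨h1, h2⟩
      rw [inf_eq_top_iff, iInf_eq_top, iInf_eq_top]
      refine ⟨fun i => ?_, fun k => ?_⟩
      · obtain ⟨k, hk⟩ := h1 i
        rw [eq_top_iff, ← (ih i (e k)).1 hk]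
        exact le_iSup (fun k => eqVal (check (d i) : QSet Q) (check (e k))) k
      · obtain ⟨i, hi⟩ := h2 k
        rw [eq_top_iff, ← (ih i (e k)).1 hi]
        exact le_iSup (fun i => eqVal (check (d i) : QSet Q) (check (e k))) i
    · intro h
      rw [PSet.Equiv, not_and_or] at h
      push Not at h
      rw [eq_bot_iff]
      rcases h with ⟨i, hi⟩ | ⟨k, hk⟩
      · refine inf_le_left.trans ((iInf_le _ i).trans (iSup_le fun k => ?_))
        exact ((ih i (e k)).2 (hi k)).le
      · refine inf_le_right.trans ((iInf_le _ k).trans (iSup_le fun i => ?_))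
        exact ((ih i (e k)).2 (hk i)).le

end Check

/-- The rank tells the codes of different rationals apart. -/
theorem rank_ofNat (m : ℕ) : (PSet.ofNat.{u} m).rank = m := by
  induction m with
  | zero => exact PSet.rank_empty
  | succ m ih =>
    rw [PSet.ofNat, PSet.rank_insert, ih]
    simp

theorem ratCode_equiv_iff {r s : ℚ} : (ratCode.{u} r).Equiv (ratCode.{u} s) ↔ r = s := by
  refine ⟨fun h => ?_, fun h => h ▸ PSet.Equiv.refl _⟩
  have := PSet.rank_congr h
  rw [ratCode, ratCode, rank_ofNat, rank_ofNat] at this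
  exact Encodable.encode_injective (by exact_mod_cast this)

section

variable {H : Type u} [NormedAddCommGroup H] [InnerProductSpace ℂ H] [CompleteSpace H]
  {M : VonNeumannAlgebra H}

/-- Equality of rational codes is two-valued, so only the term `s = r` of the membership supremum
survives. -/
theorem iSup_inf_eqVal_ratCode (f : ULift.{u} ℚ → Projection M) (r : ULift.{u} ℚ) :
    ⨆ s, f s ⊓ QSet.eqVal (QSet.check (ratCode r.down)) (QSet.check (ratCode s.down)) = f r := by
  apply le_antisymm
  · refine iSup_le fun s => ?_
    by_cases h : r.down = s.down
    · exact ULift.down_injective h ▸ inf_le_left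
    · rw [(QSet.eqVal_check Projection.compl_top_eq _ _).2 (mt ratCode_equiv_iff.1 h)]
      exact inf_le_right.trans bot_le
  · refine le_trans ?_ (le_iSup _ r)
    rw [(QSet.eqVal_check Projection.compl_top_eq _ _).1 (ratCode_equiv_iff.2 rfl), inf_top_eq]

theorem Observable.eqVal_tilde (X Y : Observable M) :
    QSet.eqVal X.tilde Y.tilde =
      (⨅ r : ULift.{u} ℚ, imp (X.resolution.proj (r.down : ℝ)) (Y.resolution.proj (r.down : ℝ))) ⊓
      (⨅ r : ULift.{u} ℚ,
        imp (Y.resolution.proj (r.down : ℝ)) (X.resolution.proj (r.down : ℝ))) := by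
  rw [QSet.eqVal_def]
  exact congrArg₂ (· ⊓ ·)
    (iInf_congr fun r => congrArg _ (iSup_inf_eqVal_ratCode
      (fun s => Y.resolution.proj (s.down : ℝ)) r))
    (iInf_congr fun r => congrArg _ (iSup_inf_eqVal_ratCode
      (fun s => X.resolution.proj (s.down : ℝ)) r))

theorem Observable.eqVal_tilde_le_imp (X Y : Observable M) (r : ℚ) :
    QSet.eqVal X.tilde Y.tilde ≤ imp (X.resolution.proj r) (Y.resolution.proj r) := by
  rw [eqVal_tilde]
  exact inf_le_left.trans (iInf_le (fun r : ULift.{u} ℚ =>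
    imp (X.resolution.proj (r.down : ℝ)) (Y.resolution.proj (r.down : ℝ))) ⟨r⟩)

theorem Observable.le_eqVal_tilde {X Y : Observable M} {f : Projection M}
    (h : ∀ r : ℚ, f ≤ imp (X.resolution.proj r) (Y.resolution.proj r))
    (h' : ∀ r : ℚ, f ≤ imp (Y.resolution.proj r) (X.resolution.proj r)) :
    f ≤ QSet.eqVal X.tilde Y.tilde := by
  rw [eqVal_tilde]
  exact le_inf (le_iInf fun r => h r.down) (le_iInf fun r => h' r.down)

end

end QuantumSet
-- Reducing projections and density
namespace QuantumSet

variable {H : Type u} [NormedAddCommGroup H] [InnerProductSpace ℂ H] [CompleteSpace H]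
  {M : VonNeumannAlgebra H}

/-- `f` commutes with every element of `D`, and the elements of `D` commute with each other on the
range of `f`. -/
structure Reduces (D : Set (Projection M)) (f : Projection M) : Prop where
  commute : ∀ d ∈ D, Commute f.op d.op
  mul_comm : ∀ d ∈ D, ∀ d' ∈ D, f.op * (d.op * d'.op) = f.op * (d'.op * d.op)

namespace Reduces

variable {D : Set (Projection M)} {f g : Projection M}

theorem of_le (hf : Reduces D f) (hg : ∀ d ∈ D, Commute g.op d.op) (h : g ≤ f) :
    Reduces D g := by
  refine ⟨hg, fun d hd d' hd' => ?_⟩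
  rw [← Projection.le_iff_mul_eq.1 h, mul_assoc, hf.mul_comm d hd d' hd', mul_assoc]

theorem inf (hf : Reduces D f) {d : Projection M} (hd : d ∈ D) : Reduces D (f ⊓ d) := by
  refine hf.of_le (fun d' hd' => ?_) inf_le_left
  rw [Projection.op_inf_of_commute (hf.commute d hd), Commute, SemiconjBy, mul_assoc,
    hf.mul_comm d hd d' hd', ← mul_assoc, (hf.commute d' hd').eq, mul_assoc]

theorem inf_compl (hf : Reduces D f) {d : Projection M} (hd : d ∈ D) : Reduces D (f ⊓ dᶜ) := by
  refine hf.of_le (fun d' hd' => ?_) inf_le_left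
  have h := (hf.inf hd).commute d' hd'
  rw [Projection.op_inf_of_commute (hf.commute d hd)] at h
  rw [Projection.op_inf_of_commute (Projection.commute_compl (hf.commute d hd)),
    Projection.op_compl, mul_sub, mul_one]
  exact (hf.commute d' hd').sub_left h

theorem le_of_inf_compl_eq_bot (hf : Reduces D f) {d : Projection M} (hd : d ∈ D)
    (h : f ⊓ dᶜ = ⊥) : f ≤ d :=
  Projection.le_of_inf_compl_eq_bot (hf.commute d hd) h

theorem le_imp (hf : Reduces D f) {p q : Projection M} (hp : p ∈ D) (hq : q ∈ D)
    (h : f ⊓ p ⊓ qᶜ = ⊥) : f ≤ imp p q := by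
  have h1 : f ⊓ p ≤ q := (hf.inf hp).le_of_inf_compl_eq_bot hq h
  exact (Projection.le_sup_of_commute (hf.commute p hp)).trans
    (sup_le_sup_left (le_inf inf_le_right h1) _)

/-- Modus ponens below `f`: the part of `f` outside `q` lies below `p ⊓ qᶜ`, hence below both `imp p
q` and its complement. -/
theorem le_of_le_imp (hf : Reduces D f) {p q : Projection M} (hq : q ∈ D)
    (h : f ≤ p) (h' : f ≤ imp p q) : f ≤ q := by
  refine hf.le_of_inf_compl_eq_bot hq
    (Projection.eq_bot_of_le_of_le_compl (inf_le_left.trans h') ?_)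
  exact (inf_le_inf_right _ h).trans (Projection.inf_compl_le_compl_imp p q)

/-- By exhaustion: the supremum of the reducing projections below both `f` and `t` commutes with
`D`, so what remains of `f` beside it again reduces `D`. A nonzero remainder would contain another
such projection, which would be orthogonal to the supremum and below it. -/
theorem le_of_dense (hf : Reduces D f) {t : Projection M}
    (h : ∀ g ≤ f, Reduces D g → g ≠ ⊥ → ∃ g' ≤ g, Reduces D g' ∧ g' ≠ ⊥ ∧ g' ≤ t) : f ≤ t := by
  set S := {g | g ≤ f ∧ Reduces D g ∧ g ≤ t}
  have hSf : sSup S ≤ f := sSup_le fun g hg => hg.1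
  have hSt : sSup S ≤ t := sSup_le fun g hg => hg.2.2
  have hcomm : Commute f.op (sSup S).op := (Projection.commute_of_le hSf).symm
  have hS : ∀ d ∈ D, Commute (sSup S).op d.op := fun d hd =>
    (Projection.commute_sSup fun g hg => (hg.2.1.commute d hd).symm).symm
  refine (Projection.le_of_inf_compl_eq_bot hcomm ?_).trans hSt
  by_contra hne
  have hred : Reduces D (f ⊓ (sSup S)ᶜ) := by
    refine hf.of_le (fun d hd => ?_) inf_le_left
    rw [Projection.op_inf_of_commute (Projection.commute_compl hcomm)]
    exact (hf.commute d hd).mul_left (Projection.commute_compl (hS d hd).symm).symm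
  obtain ⟨g, hg, hgr, hg0, hgt⟩ := h _ inf_le_left hred hne
  exact hg0 (Projection.eq_bot_of_le_of_le_compl (le_sSup (show g ∈ S from ⟨hg.trans inf_le_left, hgr, hgt⟩))
    (hg.trans inf_le_right))

/-- Finitely many dense properties that pass to smaller projections can be met together. -/
theorem exists_forall_of_dense {ι : Type*} (s : Finset ι) (P : ι → Projection M → Prop)
    (hmono : ∀ i f g, g ≤ f → P i f → P i g)
    (hdense : ∀ i f, Reduces D f → f ≠ ⊥ → ∃ g ≤ f, Reduces D g ∧ g ≠ ⊥ ∧ P i g)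
    (hf : Reduces D f) (h0 : f ≠ ⊥) :
    ∃ g ≤ f, Reduces D g ∧ g ≠ ⊥ ∧ ∀ i ∈ s, P i g := by
  classical
  induction s using Finset.induction_on with
  | empty => exact ⟨f, le_rfl, hf, h0, by simp⟩
  | insert i s _ ih =>
    obtain ⟨g, hgf, hg, hg0, hgs⟩ := ih
    obtain ⟨g', hg'g, hg', hg'0, hg'i⟩ := hdense i g hg hg0
    refine ⟨g', hg'g.trans hgf, hg', hg'0, fun k hk => ?_⟩
    rcases Finset.mem_insert.1 hk with rfl | hk
    · exact hg'i
    · exact hmono k g g' hg'g (hgs k hk)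

end Reduces

theorem reduces_of_commutator {A D : Set (Projection M)} (hDA : D ⊆ A) {e : Projection M}
    (he : e ∈ commutant A) (he' : ∀ p₁ ∈ A, ∀ p₂ ∈ A, Commutes (p₁ ⊓ e) (p₂ ⊓ e)) :
    Reduces D e := by
  have hc : ∀ d ∈ D, Commute e.op d.op := fun d hd =>
    Projection.commute_of_commutes (he d (hDA hd))
  refine ⟨hc, fun d hd d' hd' => ?_⟩
  have h := Projection.commute_of_commutes (he' d (hDA hd) d' (hDA hd'))
  rw [Projection.op_inf_of_commute (hc d hd).symm, Projection.op_inf_of_commute (hc d' hd').symm,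
    Commute, SemiconjBy] at h
  -- For operators commuting with `e`, the compressions multiply as `(a e)(b e) = e (a b)`, so
  -- commuting compressions mean commuting on the range of `e`.
  have key : ∀ a b : H →L[ℂ] H, Commute e.op a → Commute e.op b →
      a * e.op * (b * e.op) = e.op * (a * b) := by
    intro a b ha hb
    calc a * e.op * (b * e.op) = a * e.op * (e.op * b) := by rw [hb.eq]
      _ = a * (e.op * e.op) * b := by noncomm_ring
      _ = e.op * (a * b) := by rw [e.op_mul_self, ← ha.eq, mul_assoc]
  rwa [key _ _ (hc d hd) (hc d' hd'), key _ _ (hc d' hd') (hc d hd)] at h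

/-! ### Deciding the atoms -/

section Decide

variable {n : ℕ} (X : Fin n → Observable M)

/-- The values at rational numbers of the resolutions of identity of `X₁,…,Xₙ`. -/
def spectralFamily : Set (Projection M) :=
  {p | ∃ (j : Fin n) (r : ℚ), p = (X j).resolution.proj r}

theorem spectralFamily_subset_support :
    spectralFamily X ⊆ ⋃ a ∈ Set.range fun j => (X j).tilde, QSet.support a := by
  rintro _ ⟨j, r, rfl⟩
  exact Set.mem_biUnion ⟨j, rfl⟩ (Or.inr ⟨⟨r⟩, rfl⟩)

variable {X}

theorem Resolution.le_proj_of_forall_rat {E : Resolution M} {f : Projection M} {t : ℝ}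
    (h : ∀ r : ℚ, t < r → f ≤ E.proj r) : f ≤ E.proj t := by
  rw [E.rightCont t]
  refine le_iInf fun ⟨m, hm⟩ => ?_
  obtain ⟨r, hr, hrm⟩ := exists_rat_btwn (Set.mem_Ioi.1 hm)
  exact (h r hr).trans (E.mono hrm.le)

/-- `f` decides whether the observable with resolution of identity `E` is at most `t`. -/
def DecidesLE (E : Resolution M) (t : ℝ) (f : Projection M) : Prop :=
  f ≤ E.proj t ∨ f ≤ (E.proj t)ᶜ

/-- `f` decides whether `X` and `Y` are equal; if they are not, `r` separates them. -/
def DecidesEq (X Y : Observable M) (r : ℚ) (f : Projection M) : Prop :=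
  f ≤ QSet.eqVal X.tilde Y.tilde ∨
    (f ≤ (QSet.eqVal X.tilde Y.tilde)ᶜ ∧
      ((f ≤ X.resolution.proj r ∧ f ≤ (Y.resolution.proj r)ᶜ) ∨
        (f ≤ Y.resolution.proj r ∧ f ≤ (X.resolution.proj r)ᶜ)))

/-- The threshold `t` is real while `f` can be cut only at rationals. Either `f` lies below all
`E(r)` with `r > t`, and right continuity gives `E(t)`, or some such `E(r)ᶜ` meets `f`, and `E(r)ᶜ ≤
E(t)ᶜ`. -/
theorem exists_decidesLE {f : Projection M} (hf : Reduces (spectralFamily X) f) (h0 : f ≠ ⊥)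
    (j : Fin n) (t : ℝ) :
    ∃ g ≤ f, Reduces (spectralFamily X) g ∧ g ≠ ⊥ ∧ DecidesLE (X j).resolution t g := by
  by_cases h : ∀ r : ℚ, t < r → f ⊓ ((X j).resolution.proj r)ᶜ = ⊥
  · refine ⟨f, le_rfl, hf, h0, Or.inl (Resolution.le_proj_of_forall_rat fun r hr => ?_)⟩
    exact hf.le_of_inf_compl_eq_bot ⟨j, r, rfl⟩ (h r hr)
  · push Not at h
    obtain ⟨r, hr, hne⟩ := h
    refine ⟨_, inf_le_left, hf.inf_compl ⟨j, r, rfl⟩, hne, Or.inr (inf_le_right.trans ?_)⟩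
    exact Projection.compl_le_compl_of_le ((X j).resolution.mono hr.le)

/-- Equality is an infimum of implications at rationals. If one of them fails on part of `f`, that
part lies in one spectral projection at `r` and outside the other, which refutes equality; if none
fails, `f` lies below them all. -/
theorem exists_decidesEq {f : Projection M} (hf : Reduces (spectralFamily X) f) (h0 : f ≠ ⊥)
    (i j : Fin n) :
    ∃ g ≤ f, Reduces (spectralFamily X) g ∧ g ≠ ⊥ ∧ ∃ r, DecidesEq (X i) (X j) r g := by
  by_cases h : ∃ r : ℚ, f ⊓ (X i).resolution.proj r ⊓ ((X j).resolution.proj r)ᶜ ≠ ⊥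
  · obtain ⟨r, hr⟩ := h
    refine ⟨_, inf_le_left.trans inf_le_left, (hf.inf ⟨i, r, rfl⟩).inf_compl ⟨j, r, rfl⟩, hr, r,
      Or.inr ⟨?_, Or.inl ⟨inf_le_left.trans inf_le_right, inf_le_right⟩⟩⟩
    refine (inf_le_inf_right _ inf_le_right).trans
      ((Projection.inf_compl_le_compl_imp _ _).trans (Projection.compl_le_compl_of_le ?_))
    exact Observable.eqVal_tilde_le_imp _ _ r
  by_cases h' : ∃ r : ℚ, f ⊓ (X j).resolution.proj r ⊓ ((X i).resolution.proj r)ᶜ ≠ ⊥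
  · obtain ⟨r, hr⟩ := h'
    refine ⟨_, inf_le_left.trans inf_le_left, (hf.inf ⟨j, r, rfl⟩).inf_compl ⟨i, r, rfl⟩, hr, r,
      Or.inr ⟨?_, Or.inr ⟨inf_le_left.trans inf_le_right, inf_le_right⟩⟩⟩
    refine (inf_le_inf_right _ inf_le_right).trans
      ((Projection.inf_compl_le_compl_imp _ _).trans (Projection.compl_le_compl_of_le ?_))
    rw [QSet.eqVal_symm]
    exact Observable.eqVal_tilde_le_imp _ _ r
  push Not at h h'
  -- The rational `0` is arbitrary: a separating point matters only when equality fails.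
  exact ⟨f, le_rfl, hf, h0, 0, Or.inl (Observable.le_eqVal_tilde
    (fun r => hf.le_imp ⟨i, r, rfl⟩ ⟨j, r, rfl⟩ (h r))
    (fun r => hf.le_imp ⟨j, r, rfl⟩ ⟨i, r, rfl⟩ (h' r)))⟩

theorem le_proj_of_le_eqVal {f : Projection M} (hf : Reduces (spectralFamily X) f)
    {Y : Observable M} {j : Fin n} (h : f ≤ QSet.eqVal Y.tilde (X j).tilde) {t : ℝ}
    (ht : f ≤ Y.resolution.proj t) : f ≤ (X j).resolution.proj t := by
  refine Resolution.le_proj_of_forall_rat fun r hr => ?_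
  exact hf.le_of_le_imp ⟨j, r, rfl⟩ (ht.trans (Y.resolution.mono hr.le))
    (h.trans (Observable.eqVal_tilde_le_imp _ _ r))

end Decide

/-! ### From decided atoms to tautologies -/

namespace ObsProp

open Classical in
/-- The real numbers that occur in an observational proposition. -/
noncomputable def reals : ObsProp M → Finset ℝ
  | le _ x => {x}
  | eq _ _ => ∅
  | neg φ => φ.reals
  | and φ₁ φ₂ => φ₁.reals ∪ φ₂.reals

/-- A projection below the truth value of every true atom and below the complement of the truth
value of every false one does the same for all propositions. -/
theorem le_truth_of_atoms {n : ℕ} {X : Fin n → Observable M} {T : Finset ℝ} {f : Projection M}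
    {v : Observable M → ℝ}
    (hle : ∀ j, ∀ t ∈ T, (v (X j) ≤ t → f ≤ (X j).resolution.proj t) ∧
      (¬ v (X j) ≤ t → f ≤ ((X j).resolution.proj t)ᶜ))
    (heq : ∀ i j, (v (X i) = v (X j) → f ≤ QSet.eqVal (X i).tilde (X j).tilde) ∧
      (v (X i) ≠ v (X j) → f ≤ (QSet.eqVal (X i).tilde (X j).tilde)ᶜ))
    (φ : ObsProp M) (hφ : φ.InLanguage X) (hT : φ.reals ⊆ T) :
    (φ.Eval (fun Y x => v Y ≤ x) (fun Y Z => v Y = v Z) → f ≤ φ.truth) ∧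
      (¬ φ.Eval (fun Y x => v Y ≤ x) (fun Y Z => v Y = v Z) → f ≤ φ.truthᶜ) := by
  induction φ with
  | le Y x =>
    obtain ⟨j, rfl⟩ := hφ
    exact hle j x (hT (by simp [reals]))
  | eq Y Z =>
    obtain ⟨⟨i, rfl⟩, ⟨j, rfl⟩⟩ := hφ
    exact heq i j
  | neg φ ih =>
    obtain ⟨h1, h2⟩ := ih hφ hT
    refine ⟨h2, fun h => ?_⟩
    simp only [truth, Projection.compl_compl_eq]
    exact h1 (not_not.1 h)
  | and φ₁ φ₂ ih₁ ih₂ =>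
    obtain ⟨h1, h2⟩ := ih₁ hφ.1 (Finset.union_subset_left hT)
    obtain ⟨h3, h4⟩ := ih₂ hφ.2 (Finset.union_subset_right hT)
    refine ⟨fun h => le_inf (h1 h.1) (h3 h.2), fun h => ?_⟩
    rcases not_and_or.1 h with h | h
    · exact (h2 h).trans (Projection.compl_le_compl_of_le inf_le_left)
    · exact (h4 h).trans (Projection.compl_le_compl_of_le inf_le_right)

end ObsProp

open Classical in
/-- A projection that decides the order relations to the elements of `T` comes from an assignment
of real numbers. -/
theorem exists_assignment (T : Finset ℝ) (f : Projection M) :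
    ∃ v : Observable M → ℝ,
      (∀ Y, ∀ t ∈ T, v Y ≤ t ↔ f ≤ Y.resolution.proj t) ∧
      ∀ Y Z, (∀ t ∈ T, f ≤ Y.resolution.proj t ↔ f ≤ Z.resolution.proj t) → v Y = v Z := by
  obtain ⟨b, hb⟩ := T.exists_le
  -- The value of `Y` is the least threshold in `T` whose spectral projection contains `f`. The
  -- default `b + 1` exceeds all of `T`, for the case that there is none.
  let F : Observable M → Finset ℝ := fun Y =>
    insert (b + 1) (T.filter fun t => f ≤ Y.resolution.proj t)
  have hF : ∀ Y, (F Y).Nonempty := fun Y => Finset.insert_nonempty _ _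
  refine ⟨fun Y => (F Y).min' (hF Y), fun Y t ht => ⟨fun h => ?_, fun h => ?_⟩, fun Y Z h => ?_⟩
  · have hmem := (F Y).min'_mem (hF Y)
    rcases Finset.mem_insert.1 hmem with h1 | h1
    · have := hb t ht
      linarith
    · exact (Finset.mem_filter.1 h1).2.trans (Y.resolution.mono h)
  · exact Finset.min'_le _ _ (Finset.mem_insert_of_mem (Finset.mem_filter.2 ⟨ht, h⟩))
  · have : F Y = F Z := by
      simp only [F]
      rw [Finset.filter_congr h]
    simp only [this]

/-- Equalities are decided before the order atoms, because refuted equalities supply separating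
rationals that must be among the thresholds of the assignment. -/
theorem comObs_le_truth {n : ℕ} {X : Fin n → Observable M} {φ : ObsProp M}
    (hφ : φ.InLanguage X) (htaut : φ.IsTautology) : comObs X ≤ φ.truth := by
  classical
  refine sSup_le fun e ⟨he, he'⟩ => ?_
  have hred := reduces_of_commutator (spectralFamily_subset_support X) he he'
  refine hred.le_of_dense fun f _ hf hf0 => ?_
  obtain ⟨g, hgf, hg, hg0, hgeq⟩ := Reduces.exists_forall_of_dense
    (Finset.univ : Finset (Fin n × Fin n))
    (fun p g => ∃ r, DecidesEq (X p.1) (X p.2) r g)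
    (fun p f g hgf ⟨r, h⟩ => ⟨r, by
      rcases h with h | ⟨h, ⟨h1, h2⟩ | ⟨h1, h2⟩⟩
      · exact Or.inl (hgf.trans h)
      · exact Or.inr ⟨hgf.trans h, Or.inl ⟨hgf.trans h1, hgf.trans h2⟩⟩
      · exact Or.inr ⟨hgf.trans h, Or.inr ⟨hgf.trans h1, hgf.trans h2⟩⟩⟩)
    (fun p f hf h0 => exists_decidesEq hf h0 p.1 p.2) hf hf0
  choose r hr using fun p => hgeq p (Finset.mem_univ p)
  -- With the separating rationals in `T`, observables that `g` forces to differ receive different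
  -- real values.
  let T : Finset ℝ := φ.reals ∪ Finset.univ.image fun p => (r p : ℝ)
  obtain ⟨k, hkg, hk, hk0, hkle⟩ := Reduces.exists_forall_of_dense
    ((Finset.univ : Finset (Fin n)) ×ˢ T)
    (fun p g => DecidesLE (X p.1).resolution p.2 g)
    (fun p f g hgf h => h.imp hgf.trans hgf.trans)
    (fun p f hf h0 => exists_decidesLE hf h0 p.1 p.2) hg hg0
  refine ⟨k, hkg.trans hgf, hk, hk0, ?_⟩
  obtain ⟨v, hv, hvY⟩ := exists_assignment T k
  refine (ObsProp.le_truth_of_atoms (fun j t ht => ⟨(hv _ t ht).1, fun h => ?_⟩) (fun i j => ?_)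
    φ hφ Finset.subset_union_left).1 (htaut v)
  · exact (hkle (j, t) (Finset.mem_product.2 ⟨Finset.mem_univ _, ht⟩)).resolve_left
      fun h' => h ((hv _ t ht).2 h')
  · have hrT : (r (i, j) : ℝ) ∈ T :=
      Finset.mem_union_right _ (Finset.mem_image_of_mem _ (Finset.mem_univ _))
    rcases hr (i, j) with h | ⟨h, h'⟩
    · have h1 := hkg.trans h
      -- Below a forced equality both observables have the same thresholds in `T`, hence the same
      -- value.
      refine ⟨fun _ => h1, fun hne => (hne (hvY _ _ fun t _ => ⟨?_, ?_⟩)).elim⟩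
      · exact le_proj_of_le_eqVal hk h1
      · rw [QSet.eqVal_symm] at h1
        exact le_proj_of_le_eqVal hk h1
    -- Equal values would put `k` below a spectral projection at `r (i, j)` and below its
    -- complement.
    · refine ⟨fun heq => (hk0 ?_).elim, fun _ => hkg.trans h⟩
      rcases h' with ⟨h1, h2⟩ | ⟨h1, h2⟩
      · refine Projection.eq_bot_of_le_of_le_compl ?_ (hkg.trans h2)
        rw [← hv _ _ hrT, ← heq, hv _ _ hrT]
        exact hkg.trans h1
      · refine Projection.eq_bot_of_le_of_le_compl ?_ (hkg.trans h2)
        rw [← hv _ _ hrT, heq, hv _ _ hrT]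
        exact hkg.trans h1

end QuantumSet
-- Traces and states
namespace QuantumSet

section Trace

variable {H : Type u} [NormedAddCommGroup H] [InnerProductSpace ℂ H]

theorem hasSum_norm_inner_sq {ι : Type*} (b : HilbertBasis ι ℂ H) (x : H) :
    HasSum (fun i => ‖inner ℂ (b i) x‖ ^ 2) (‖x‖ ^ 2) := by
  have h := b.hasSum_inner_mul_inner x x
  have h2 : ∀ i, inner ℂ x (b i) * inner ℂ (b i) x = ((‖inner ℂ (b i) x‖ ^ 2 : ℝ) : ℂ) :=
    fun i => by
      rw [← inner_conj_symm, Complex.conj_mul']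
      push_cast
      rfl
  have h3 : inner ℂ x x = ((‖x‖ ^ 2 : ℝ) : ℂ) := by
    rw [inner_self_eq_norm_sq_to_K]
    norm_cast
  rw [funext h2, h3] at h
  exact Complex.hasSum_ofReal.1 h

theorem summable_norm_inner_sq {ι : Type*} (b : HilbertBasis ι ℂ H) {g : ι → H}
    (hg : Summable fun i => ‖g i‖ ^ 2) :
    Summable fun p : ι × ι => ‖inner ℂ (b p.2) (g p.1)‖ ^ 2 := by
  rw [summable_prod_of_nonneg (fun p => sq_nonneg _)]
  refine ⟨fun i => (hasSum_norm_inner_sq b (g i)).summable, ?_⟩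
  exact hg.congr fun i => (hasSum_norm_inner_sq b (g i)).tsum_eq.symm

variable [CompleteSpace H]

/-- For a projection `P` and a self-adjoint Hilbert-Schmidt operator `R`, the trace of `P R²` is
the square of the Hilbert-Schmidt norm of `P R`. -/
theorem tsum_inner_mul_mul_self {ι : Type*} (b : HilbertBasis ι ℂ H) {P R : H →L[ℂ] H}
    (hP : IsStarProjection P) (hR : IsSelfAdjoint R) (hs : Summable fun i => ‖R (b i)‖ ^ 2) :
    ∑' i, inner ℂ (b i) ((P * (R * R)) (b i)) = ((∑' i, ‖P (R (b i))‖ ^ 2 : ℝ) : ℂ) := by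
  have hPs : ∀ x y, inner ℂ (P x) y = inner ℂ x (P y) := fun x y =>
    (hP.isSelfAdjoint.isSymmetric x y)
  have hRs : ∀ x y, inner ℂ (R x) y = inner ℂ x (R y) := fun x y => (hR.isSymmetric x y)
  have hPP : ∀ x, P (P x) = P x := fun x => DFunLike.congr_fun hP.isIdempotentElem.eq x
  -- Parseval turns the trace, as `⟨R P bᵢ, R bᵢ⟩` summed over `i`, into a double series; exchanging
  -- the sums collects the squares `‖P R bⱼ‖²`.
  let F : ι × ι → ℂ := fun p => inner ℂ (R (P (b p.1))) (b p.2) * inner ℂ (b p.2) (R (b p.1))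
  have hsum2 := summable_norm_inner_sq b hs
  have hle : ∀ x, ‖P x‖ ≤ ‖x‖ := fun x => by
    simpa using P.le_of_opNorm_le hP.norm_le x
  have hsP : Summable fun i => ‖P (R (b i))‖ ^ 2 :=
    hs.of_nonneg_of_le (fun i => by positivity) fun i => by gcongr; exact hle _
  -- Moving `R` and `P` across gives `⟨bᵢ, P R bⱼ⟩`, the transpose of a square-summable family.
  have hsum1 : Summable fun p : ι × ι => ‖inner ℂ (R (P (b p.1))) (b p.2)‖ ^ 2 := by
    refine (summable_norm_inner_sq b hsP).prod_symm.congr fun p => ?_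
    rw [hRs, hPs]
    rfl
  have hF : Summable F := by
    refine Summable.of_norm_bounded (hsum1.add hsum2) fun p => ?_
    rw [norm_mul]
    nlinarith [sq_nonneg (‖inner ℂ (R (P (b p.1))) (b p.2)‖ - ‖inner ℂ (b p.2) (R (b p.1))‖),
      sq_nonneg (‖inner ℂ (R (P (b p.1))) (b p.2)‖), sq_nonneg (‖inner ℂ (b p.2) (R (b p.1))‖)]
  calc ∑' i, inner ℂ (b i) ((P * (R * R)) (b i)) = ∑' i, ∑' j, F (i, j) := by
        refine tsum_congr fun i => ?_
        refine Eq.trans ?_ (b.tsum_inner_mul_inner (R (P (b i))) (R (b i))).symm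
        change inner ℂ (b i) (P (R (R (b i)))) = _
        rw [hRs, hPs]
    _ = ∑' j, ∑' i, F (i, j) := (hF.tsum_comm (f := fun i j => F (i, j))).symm
    _ = ∑' j, ((‖P (R (b j))‖ ^ 2 : ℝ) : ℂ) := by
        refine tsum_congr fun j => ?_
        have : ∀ i, F (i, j) = inner ℂ (R (b j)) (b i) * inner ℂ (b i) (P (R (b j))) := by
          intro i
          simp only [F]
          rw [hRs (P (b i)), hPs, hRs (b j), mul_comm]
        simp only [this]
        rw [b.tsum_inner_mul_inner, ← hPP (R (b j)), ← hPs, hPP, inner_self_eq_norm_sq_to_K]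
        norm_cast
    _ = _ := by rw [Complex.ofReal_tsum]

/-- With `R = √ρ`, both `‖R‖` and `‖P R‖` have Hilbert-Schmidt norm one. By Pythagoras `(1 - P) R`
has norm zero, so `P R = R`, and multiplying by `R` gives the claim. -/
theorem mul_eq_of_trace_mul_eq_one {P : H →L[ℂ] H} (hP : IsStarProjection P)
    (ρ : DensityOperator H) (h : trace (P * ρ.op) = 1) : P * ρ.op = ρ.op := by
  set b := hilbertBasis H
  have hρ : 0 ≤ ρ.op := (ContinuousLinearMap.nonneg_iff_isPositive _).2 ρ.isPositive
  set R := CFC.sqrt ρ.op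
  have hRR : R * R = ρ.op := CFC.sqrt_mul_sqrt_self ρ.op hρ
  have hR : IsSelfAdjoint R := (CFC.sqrt_nonneg ρ.op).isSelfAdjoint
  have h1 : HasSum (fun i => ‖R (b i)‖ ^ 2) 1 := by
    have := ρ.hasTrace_one
    rw [← hRR] at this
    have hRs : ∀ x y, inner ℂ (R x) y = inner ℂ x (R y) := fun x y => hR.isSymmetric x y
    have h2 : ∀ i, inner ℂ (b i) ((R * R) (b i)) = ((‖R (b i)‖ ^ 2 : ℝ) : ℂ) := fun i => by
      change inner ℂ (b i) (R (R (b i))) = _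
      rw [← hRs, inner_self_eq_norm_sq_to_K]
      norm_cast
    rw [funext h2, ← Complex.ofReal_one] at this
    exact Complex.hasSum_ofReal.1 this
  have hle : ∀ x, ‖P x‖ ≤ ‖x‖ := fun x => by
    simpa using P.le_of_opNorm_le hP.norm_le x
  have hpyth : ∀ x, ‖x‖ ^ 2 = ‖P x‖ ^ 2 + ‖x - P x‖ ^ 2 := by
    obtain ⟨_, hP'⟩ := isStarProjection_iff_eq_starProjection_range.1 hP
    intro x
    have := Submodule.norm_sq_eq_add_norm_sq_starProjection x P.range
    rwa [Submodule.starProjection_orthogonal_val, ← hP'] at this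
  have hsP : Summable fun i => ‖P (R (b i))‖ ^ 2 :=
    h1.summable.of_nonneg_of_le (fun i => by positivity) fun i => by gcongr; exact hle _
  have h2 : ∑' i, ‖P (R (b i))‖ ^ 2 = 1 := by
    have := tsum_inner_mul_mul_self b hP hR h1.summable
    rw [hRR] at this
    exact_mod_cast this.symm.trans h
  have h3 : HasSum (fun i => ‖R (b i) - P (R (b i))‖ ^ 2) 0 := by
    have := h1.sub hsP.hasSum
    rw [h2, sub_self] at this
    refine this.congr_fun fun i => ?_
    rw [hpyth (R (b i)), add_sub_cancel_left]
  have h4 : ∀ i, P (R (b i)) = R (b i) := fun i => by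
    have := congrFun ((hasSum_zero_iff_of_nonneg fun i => by positivity).1 h3) i
    exact (sub_eq_zero.1 (norm_eq_zero.1 (pow_eq_zero_iff two_ne_zero |>.1 this))).symm
  have h5 : P * R = R := by
    refine ContinuousLinearMap.ext_on (s := Set.range b) ?_ ?_
    · rw [Submodule.dense_iff_topologicalClosure_eq_top]
      exact b.dense_span
    · rintro _ ⟨i, rfl⟩
      exact h4 i
  rw [← hRR, ← mul_assoc, h5]

end Trace

end QuantumSet

theorem mainTheorem3 {H : Type u} [NormedAddCommGroup H] [InnerProductSpace ℂ H]
    [CompleteSpace H] (M : VonNeumannAlgebra H) {n : ℕ} (X : Fin n → QuantumSet.Observable M)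
    (φ : QuantumSet.ObsProp M) (hφ : φ.InLanguage X) (htaut : φ.IsTautology) :
    QuantumSet.comObs X ≤ φ.truth ∧
      ∀ ρ : QuantumSet.DensityOperator H,
        φ.ContextuallyWellFormed X ρ → φ.Holds ρ := by
  have hle := QuantumSet.comObs_le_truth hφ htaut
  refine ⟨hle, fun ρ hρ => ?_⟩
  have h1 := QuantumSet.mul_eq_of_trace_mul_eq_one (QuantumSet.comObs X).isStarProjection ρ hρ.2
  have h2 : φ.truth.op * (QuantumSet.comObs X).op = (QuantumSet.comObs X).op :=
    (QuantumSet.Projection.commute_of_le hle).eq.symm.trans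
      (QuantumSet.Projection.le_iff_mul_eq.1 hle)
  -- With `C` the commutator and `T` the truth value, `T ρ = T C ρ = C ρ = ρ`.
  rw [QuantumSet.ObsProp.Holds, ← h1, ← mul_assoc, h2, h1]
  exact ρ.hasTrace_one.tsum_eq
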